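/- Let $A$ be a unital complex Banach algebra (the norm is complete and submultiplicative). A left Banach $A$-module is a complex Banach space $Y$ with a bilinear associative action $A\times Y\to Y$ such that $\|a\cdot y\|\le\|a\|\,\|y\|$; it is unital if $1\cdot y=y$ for all $y\in Y$. A morphism of left Banach $A$-modules is a bounded linear operator commuting with the action of $A$; it is contractive if $\|\varphi(y)\|\le\|y\|$ for all $y$, and a monomorphism if it is injective. A morphism $\psi\colon Y\to X$ is small if every morphism $\varphi\colon Z\to X$ of left Banach $A$-modules for which $Z\oplus Y\to X$, $(z,y)\mapsto\varphi(z)+\psi(y)$, is surjective is itself surjective. A contractive monomorphism $\alpha\colon Y\to X$ is maximal if it is not surjective and, for every non-surjective contractive monomorphism $\beta\colon Z\to X$ and every contractive morphism $\kappa\colon Y\to Z$, the equality $\alpha=\beta\kappa$ implies that $\kappa$ is an isometric isomorphism. Theorem. Let $X$ be a unital left Banach $A$-module. Let $X_1=\bigcup_\psi\operatorname{Im}\psi$, where $\psi$ runs over all small morphisms with range in $X$, and let $X_2=\bigcap_\iota\operatorname{Im}\iota$, where $\iota$ runs over all maximal contractive monomorphisms with range in $X$ (so $X_2=X$ if there are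 none). Then $X_1=X_2$, and this set is a closed $A$-submodule of $X$. (It is called the topological radical of $X$ and denoted $\operatorname{trad}X$.) -/

import Mathlib

universe u v w

/-- The laws of a left Banach module `Y` over a Banach algebra `A`: a (not necessarily unital)
bilinear, associative action on the Banach space `Y` whose multiplication has norm at most `1`.
Completeness is carried by the separate instance `CompleteSpace Y`. -/
class LeftBanachModule (A : Type u) (Y : Type w) [NormedRing A] [NormedAlgebra ℂ A]
    [NormedAddCommGroup Y] [NormedSpace ℂ Y] [CompleteSpace Y] [SMul A Y] : Prop where
  act_add : ∀ (a : A) (y z : Y), a • (y + z) = a • y + a • z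
  add_act : ∀ (a b : A) (y : Y), (a + b) • y = a • y + b • y
  mul_act : ∀ (a b : A) (y : Y), (a * b) • y = a • (b • y)
  smul_act : ∀ (c : ℂ) (a : A) (y : Y), (c • a) • y = c • (a • y)
  act_smul : ∀ (c : ℂ) (a : A) (y : Y), a • (c • y) = c • (a • y)
  norm_act_le : ∀ (a : A) (y : Y), ‖a • y‖ ≤ ‖a‖ * ‖y‖

/-- Unital left Banach modules, expressed by Mathlib's classes, are left Banach modules. -/
instance LeftBanachModule.of_unital (A : Type u) (X : Type v) [NormedRing A] [NormedAlgebra ℂ A]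
    [NormedAddCommGroup X] [NormedSpace ℂ X] [CompleteSpace X]
    [Module A X] [IsScalarTower ℂ A X] [IsBoundedSMul A X] : LeftBanachModule A X where
  act_add := smul_add
  add_act := add_smul
  mul_act := mul_smul
  smul_act := smul_assoc
  act_smul c a y := by
    rw [← algebraMap_smul A c y, ← algebraMap_smul A c (a • y), ← mul_smul, ← mul_smul,
      Algebra.commutes]
  norm_act_le := norm_smul_le

section Morphisms

variable (A : Type u) {X : Type v} [NormedRing A] [NormedAlgebra ℂ A]
  [NormedAddCommGroup X] [NormedSpace ℂ X] [CompleteSpace X] [SMul A X] [LeftBanachModule A X]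
  {Y : Type w} [NormedAddCommGroup Y] [NormedSpace ℂ Y] [CompleteSpace Y] [SMul A Y]
  [LeftBanachModule A Y]

/-- A morphism of left Banach `A`-modules: a bounded linear operator commuting with the action. -/
def IsBanachModuleMorphism (φ : Y →L[ℂ] X) : Prop :=
  ∀ (a : A) (y : Y), φ (a • y) = a • φ y

/-- A contractive morphism of left Banach `A`-modules. -/
def IsContractiveMorphism (φ : Y →L[ℂ] X) : Prop :=
  IsBanachModuleMorphism A φ ∧ ∀ y : Y, ‖φ y‖ ≤ ‖y‖

/-- A contractive monomorphism of left Banach `A`-modules. -/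
def IsContractiveMonomorphism (φ : Y →L[ℂ] X) : Prop :=
  IsContractiveMorphism A φ ∧ Function.Injective φ

/-- A morphism `ψ : Y → X` is small if every morphism `φ : Z → X` for which
`Z ⊕ Y → X, (z, y) ↦ φ z + ψ y` is surjective is itself surjective. -/
def IsSmallMorphism (ψ : Y →L[ℂ] X) : Prop :=
  IsBanachModuleMorphism A ψ ∧
    ∀ (Z : Type (max u v)) [NormedAddCommGroup Z] [NormedSpace ℂ Z] [CompleteSpace Z] [SMul A Z]
      [LeftBanachModule A Z] (φ : Z →L[ℂ] X), IsBanachModuleMorphism A φ →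
        Function.Surjective (φ.coprod ψ) → Function.Surjective φ

/-- A contractive monomorphism `α : Y → X` is maximal if it is not surjective and, whenever
`α = β κ` with `β` a non-surjective contractive monomorphism and `κ` a contractive morphism,
`κ` is an isometric isomorphism. -/
def IsMaximalContractiveMonomorphism (α : Y →L[ℂ] X) : Prop :=
  IsContractiveMonomorphism A α ∧ ¬ Function.Surjective α ∧
    ∀ (Z : Type (max u v)) [NormedAddCommGroup Z] [NormedSpace ℂ Z] [CompleteSpace Z] [SMul A Z]
      [LeftBanachModule A Z] (β : Z →L[ℂ] X) (κ : Y →L[ℂ] Z),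
        IsContractiveMonomorphism A β → ¬ Function.Surjective β →
          IsContractiveMorphism A κ → α = β.comp κ → Isometry κ ∧ Function.Surjective κ

end Morphisms

section Radical

variable (A : Type u) (X : Type v) [NormedRing A] [NormedAlgebra ℂ A]
  [NormedAddCommGroup X] [NormedSpace ℂ X] [CompleteSpace X] [SMul A X] [LeftBanachModule A X]

/-- The union of the ranges of all small morphisms into `X`. -/
def smallRangeUnion : Set X :=
  {x | ∃ (Y : Type (max u v)) (_ : NormedAddCommGroup Y) (_ : NormedSpace ℂ Y)
    (_ : CompleteSpace Y) (_ : SMul A Y) (_ : LeftBanachModule A Y) (ψ : Y →L[ℂ] X),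
      IsSmallMorphism A ψ ∧ x ∈ Set.range ψ}

/-- The intersection of the ranges of all maximal contractive monomorphisms into `X`
(all of `X` if there are none). -/
def maximalRangeInter : Set X :=
  {x | ∀ (Y : Type (max u v)) [NormedAddCommGroup Y] [NormedSpace ℂ Y] [CompleteSpace Y]
    [SMul A Y] [LeftBanachModule A Y] (ι : Y →L[ℂ] X),
      IsMaximalContractiveMonomorphism A ι → x ∈ Set.range ι}

end Radical

/-! Both sets equal the intersection of all closed maximal submodules of `X`; the proof is a cycle
of three inclusions.

For `ψ` small and `ι` maximal, the sum of their ranges is the range of a contractive monomorphism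
`β` through which `ι` factors: rescale `ψ` to a contraction and divide the `ℓ¹`-sum by the kernel
(`exists_contractiveMonomorphism_coprod`). Smallness forbids `β` to be surjective, and then
maximality makes its range equal to that of `ι`.

The inclusion of a closed maximal submodule is a maximal contractive monomorphism
(`mem_of_mem_maximalRangeInter`).

If `x` lies in every closed maximal submodule, then `a ↦ a • x` is small, and its range contains `x
= 1 • x`. Otherwise some proper range `N` satisfies `N + A x = X`. A submodule maximal among those
containing `N` but not `x` is a maximal submodule, and it is closed by the open mapping theorem and
the invertibility of `1 - a` for `‖a‖ < 1`. -/

namespace LeftBanachModule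

/-! ### Quotients by kernels -/

section Quotient

variable {A : Type u} [NormedRing A] [NormedAlgebra ℂ A]
  {Y : Type w} [NormedAddCommGroup Y] [NormedSpace ℂ Y] [CompleteSpace Y] [SMul A Y]
  [LeftBanachModule A Y]

variable (Y) in
/-- The action of an element of the algebra as a `ℂ`-linear map. -/
def actLinear (a : A) : Y →ₗ[ℂ] Y where
  toFun y := a • y
  map_add' := act_add a
  map_smul' c y := act_smul c a y

variable {X : Type v} [NormedAddCommGroup X] [NormedSpace ℂ X] [CompleteSpace X] [SMul A X]
  [LeftBanachModule A X]

theorem act_zero (a : A) : a • (0 : X) = 0 := (actLinear X a).map_zero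

/-- A contractive morphism factors as a contractive morphism onto a Banach module followed by a
contractive monomorphism. -/
theorem exists_factorization {φ : Y →L[ℂ] X} (hφ : IsContractiveMorphism A φ) :
    ∃ (Q : Type w) (_ : NormedAddCommGroup Q) (_ : NormedSpace ℂ Q) (_ : CompleteSpace Q)
      (_ : SMul A Q) (_ : LeftBanachModule A Q) (β : Q →L[ℂ] X) (κ : Y →L[ℂ] Q),
      IsContractiveMonomorphism A β ∧ IsContractiveMorphism A κ ∧ φ = β.comp κ ∧
        Function.Surjective κ := by
  let K : Submodule ℂ Y := LinearMap.ker φ.toLinearMap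
  have : IsClosed (K : Set Y) := φ.isClosed_ker
  have hK (a : A) : K ≤ K.comap (actLinear Y a) := by
    intro y hy
    have hy' : φ y = 0 := hy
    change φ (a • y) = 0
    rw [hφ.1, hy', act_zero]
  let : SMul A (Y ⧸ K) := ⟨fun a => K.mapQ K (actLinear Y a) (hK a)⟩
  have smul_mk (a : A) (y : Y) : a • (K.mkQ y) = K.mkQ (a • y) := rfl
  have surj := K.mkQ_surjective
  have : LeftBanachModule A (Y ⧸ K) :=
    { act_add := fun a p q => (K.mapQ K (actLinear Y a) (hK a)).map_add p q
      act_smul := fun c a q => (K.mapQ K (actLinear Y a) (hK a)).map_smul c q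
      add_act := fun a b q => by
        obtain ⟨y, rfl⟩ := surj q
        simp only [smul_mk, add_act, map_add]
      mul_act := fun a b q => by
        obtain ⟨y, rfl⟩ := surj q
        simp only [smul_mk, mul_act]
      smul_act := fun c a q => by
        obtain ⟨y, rfl⟩ := surj q
        simp only [smul_mk, smul_act, map_smul]
      norm_act_le := fun a q => by
        -- The quotient norm is an infimum that need not be attained; hence the slack `ε`, which
        -- then tends to `0`.
        have key (ε : ℝ) (hε : 0 < ε) : ‖a • q‖ ≤ ‖a‖ * (‖q‖ + ε) := by
          obtain ⟨y, rfl, hy⟩ := Submodule.Quotient.norm_mk_lt q hε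
          calc ‖K.mkQ (a • y)‖ ≤ ‖a • y‖ := Submodule.Quotient.norm_mk_le _ _
            _ ≤ ‖a‖ * ‖y‖ := norm_act_le a y
            _ ≤ _ := by gcongr
        refine ge_of_tendsto (x := nhdsWithin (0 : ℝ) (Set.Ioi 0))
          (f := fun ε : ℝ => ‖a‖ * (‖q‖ + ε)) ?_ (eventually_mem_nhdsWithin.mono key)
        refine tendsto_nhdsWithin_of_tendsto_nhds ?_
        have : Continuous fun ε : ℝ => ‖a‖ * (‖q‖ + ε) := by fun_prop
        simpa using this.tendsto 0 }
  let β₀ : (Y ⧸ K) →ₗ[ℂ] X := K.liftQ φ.toLinearMap le_rfl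
  have β₀_mk (y : Y) : β₀ (K.mkQ y) = φ y := rfl
  have β₀_norm (q : Y ⧸ K) : ‖β₀ q‖ ≤ ‖q‖ := by
    refine le_of_forall_pos_le_add fun ε hε => ?_
    obtain ⟨y, rfl, hy⟩ := Submodule.Quotient.norm_mk_lt q hε
    exact (hφ.2 y).trans hy.le
  refine ⟨Y ⧸ K, inferInstance, inferInstance, inferInstance, inferInstance, inferInstance,
    β₀.mkContinuous 1 fun q => by simpa using β₀_norm q,
    K.mkQ.mkContinuous 1 fun y => by
      simpa using Submodule.Quotient.norm_mk_le K y,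
    ⟨⟨fun a q => ?_, β₀_norm⟩, ?_⟩, ⟨fun a y => rfl, Submodule.Quotient.norm_mk_le K⟩, rfl, surj⟩
  · obtain ⟨y, rfl⟩ := surj q
    exact hφ.1 a y
  · exact LinearMap.ker_eq_bot.mp (Submodule.ker_liftQ_eq_bot _ _ _ le_rfl)

end Quotient

/-! ### `ℓ¹`-sums -/

section Sum

variable (A : Type u) [NormedRing A] [NormedAlgebra ℂ A]
  (Y : Type w) [NormedAddCommGroup Y] [NormedSpace ℂ Y] [CompleteSpace Y] [SMul A Y]
  [LeftBanachModule A Y]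
  (Z : Type w) [NormedAddCommGroup Z] [NormedSpace ℂ Z] [CompleteSpace Z] [SMul A Z]
  [LeftBanachModule A Z]

/-- The `ℓ¹`-sum of two left Banach modules is a left Banach module. -/
theorem withLp_one_prod : LeftBanachModule A (WithLp 1 (Y × Z)) where
  act_add a y z := WithLp.ofLp_injective 1 (Prod.ext (act_add a _ _) (act_add a _ _))
  add_act a b y := WithLp.ofLp_injective 1 (Prod.ext (add_act a b _) (add_act a b _))
  mul_act a b y := WithLp.ofLp_injective 1 (Prod.ext (mul_act a b _) (mul_act a b _))
  smul_act c a y := WithLp.ofLp_injective 1 (Prod.ext (smul_act c a _) (smul_act c a _))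
  act_smul c a y := WithLp.ofLp_injective 1 (Prod.ext (act_smul c a _) (act_smul c a _))
  norm_act_le a y := by
    rw [WithLp.prod_norm_eq_of_L1, WithLp.prod_norm_eq_of_L1, mul_add]
    exact add_le_add (norm_act_le a y.fst) (norm_act_le a y.snd)

variable {A Y Z} {X : Type v} [NormedAddCommGroup X] [NormedSpace ℂ X] [CompleteSpace X] [SMul A X]
  [LeftBanachModule A X]

/-- The sum of the ranges of two contractive morphisms is the range of a contractive monomorphism
through which the first morphism factors contractively. -/
theorem exists_contractiveMonomorphism_coprod {φ : Y →L[ℂ] X} {ψ : Z →L[ℂ] X}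
    (hφ : IsContractiveMorphism A φ) (hψ : IsContractiveMorphism A ψ) :
    ∃ (Q : Type w) (_ : NormedAddCommGroup Q) (_ : NormedSpace ℂ Q) (_ : CompleteSpace Q)
      (_ : SMul A Q) (_ : LeftBanachModule A Q) (β : Q →L[ℂ] X) (κ : Y →L[ℂ] Q),
      IsContractiveMonomorphism A β ∧ IsContractiveMorphism A κ ∧ φ = β.comp κ ∧
        Set.range β = Set.range (φ.coprod ψ) := by
  have := withLp_one_prod A Y Z
  let e := WithLp.prodContinuousLinearEquiv 1 ℂ Y Z
  let σ : WithLp 1 (Y × Z) →L[ℂ] X := (φ.coprod ψ).comp e.toContinuousLinearMap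
  have σ_apply (p) : σ p = φ p.fst + ψ p.snd := rfl
  have hσ : IsContractiveMorphism A σ := by
    refine ⟨fun a p => ?_, fun p => ?_⟩
    · rw [σ_apply, σ_apply, act_add]
      exact congrArg₂ _ (hφ.1 a _) (hψ.1 a _)
    -- The `ℓ¹` norm is what makes the sum of two contractions a contraction; the supremum norm
    -- would only give the bound `2`.
    · rw [σ_apply, WithLp.prod_norm_eq_of_L1]
      exact (norm_add_le _ _).trans (add_le_add (hφ.2 _) (hψ.2 _))
  let i : Y →L[ℂ] WithLp 1 (Y × Z) :=
    e.symm.toContinuousLinearMap.comp (ContinuousLinearMap.inl ℂ Y Z)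
  have i_fst (y) : (i y).fst = y := rfl
  have i_snd (y) : (i y).snd = 0 := rfl
  obtain ⟨Q, _, _, _, _, _, β, κ, hβ, hκ, hσβ, hsurj⟩ := exists_factorization hσ
  refine ⟨Q, inferInstance, inferInstance, inferInstance, inferInstance, inferInstance, β,
    κ.comp i, hβ, ⟨fun a y => ?_, fun y => ?_⟩, ?_, ?_⟩
  · have : i (a • y) = a • i y :=
      WithLp.ofLp_injective 1 (Prod.ext rfl (act_zero (X := Z) a).symm)
    rw [ContinuousLinearMap.comp_apply, this, hκ.1]
    rfl
  · refine (hκ.2 _).trans ?_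
    rw [WithLp.prod_norm_eq_of_L1]
    change ‖y‖ + ‖(0 : Z)‖ ≤ ‖y‖
    rw [norm_zero, add_zero]
  · rw [← ContinuousLinearMap.comp_assoc, ← hσβ]
    ext y
    rw [ContinuousLinearMap.comp_apply, σ_apply, i_fst, i_snd, map_zero, add_zero]
  · rw [← hsurj.range_comp, ← ContinuousLinearMap.coe_comp, ← hσβ,
      ContinuousLinearMap.coe_comp, Set.range_comp]
    exact congrArg _ (e.surjective.range_eq) |>.trans Set.image_univ

end Sum

/-! ### Small morphisms against maximal monomorphisms -/

section SmallMaximal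

variable {A : Type u} [NormedRing A] [NormedAlgebra ℂ A]
  {X : Type v} [NormedAddCommGroup X] [NormedSpace ℂ X] [CompleteSpace X] [SMul A X]
  [LeftBanachModule A X]

/-- Adding the range of `ψ` to that of `ι` cannot give all of `X`, by smallness, so by maximality it
adds nothing. -/
theorem range_smallMorphism_subset_range_maximal
    {Y : Type (max u v)} [NormedAddCommGroup Y] [NormedSpace ℂ Y] [CompleteSpace Y] [SMul A Y]
    [LeftBanachModule A Y]
    {Z : Type (max u v)} [NormedAddCommGroup Z] [NormedSpace ℂ Z] [CompleteSpace Z] [SMul A Z]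
    [LeftBanachModule A Z] {ψ : Y →L[ℂ] X} {ι : Z →L[ℂ] X} (hψ : IsSmallMorphism A ψ)
    (hι : IsMaximalContractiveMonomorphism A ι) : Set.range ψ ⊆ Set.range ι := by
  have hr : 0 < ‖ψ‖ + 1 := by positivity
  -- Scaling by `c` makes `ψ` contractive without changing its range; the `+ 1` covers `ψ = 0`.
  let c : ℂ := ((‖ψ‖ + 1)⁻¹ : ℝ)
  have hc : c ≠ 0 := Complex.ofReal_ne_zero.mpr (inv_pos.mpr hr).ne'
  have hcψ : IsContractiveMorphism A (c • ψ) := by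
    refine ⟨fun a y => ?_, fun y => ?_⟩
    · rw [smul_apply, smul_apply, hψ.1, act_smul]
    · rw [smul_apply, norm_smul, Complex.norm_real, Real.norm_eq_abs,
        abs_of_pos (inv_pos.mpr hr), inv_mul_le_iff₀ hr]
      exact (ψ.le_opNorm y).trans (by gcongr; linarith)
  obtain ⟨Q, _, _, _, _, _, β, κ, hβ, hκ, hικ, hrange⟩ :=
    exists_contractiveMonomorphism_coprod hι.1.1 hcψ
  by_cases hsurj : Function.Surjective β
  · refine absurd (hψ.2 Z ι hι.1.1.1 fun x => ?_) hι.2.1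
    obtain ⟨p, hp⟩ : x ∈ Set.range (ι.coprod (c • ψ)) := hrange ▸ hsurj x
    refine ⟨(p.1, c • p.2), ?_⟩
    simpa using hp
  · obtain ⟨-, hκs⟩ := hι.2.2 Q β κ hβ hsurj hκ hικ
    rintro _ ⟨y, rfl⟩
    have : ψ y ∈ Set.range β := hrange ▸ ⟨(0, c⁻¹ • y), by simp [smul_smul, hc]⟩
    obtain ⟨q, hq⟩ := this
    obtain ⟨z, rfl⟩ := hκs q
    exact ⟨z, by rw [hικ, ← hq]; rfl⟩

end SmallMaximal

/-! ### Closed maximal submodules of a unital module -/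

section Unital

variable {A : Type u} [NormedRing A] [NormedAlgebra ℂ A]
  {X : Type v} [NormedAddCommGroup X] [NormedSpace ℂ X] [CompleteSpace X]
  [Module A X] [IsScalarTower ℂ A X] [IsBoundedSMul A X]

/-- The range of a morphism into a unital module as a submodule. -/
def rangeSubmodule {Z : Type w} [NormedAddCommGroup Z] [NormedSpace ℂ Z] [CompleteSpace Z]
    [SMul A Z] [LeftBanachModule A Z] (φ : Z →L[ℂ] X) (hφ : IsBanachModuleMorphism A φ) :
    Submodule A X where
  carrier := Set.range φ
  add_mem' := by
    rintro _ _ ⟨y, rfl⟩ ⟨z, rfl⟩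
    exact ⟨y + z, map_add φ y z⟩
  zero_mem' := ⟨0, map_zero φ⟩
  smul_mem' := by
    rintro a _ ⟨z, rfl⟩
    exact ⟨a • z, hφ a z⟩

/-- A closed maximal submodule contains the intersection of the ranges of all maximal contractive
monomorphisms, since its inclusion is one of them. -/
theorem mem_of_mem_maximalRangeInter {M : Submodule A X} (hM : IsCoatom M)
    (hclosed : IsClosed (M : Set X)) {x : X} (hx : x ∈ maximalRangeInter A X) : x ∈ M := by
  let N : Submodule ℂ X := M.restrictScalars ℂ
  have : CompleteSpace M := hclosed.completeSpace_coe
  have hcomm (c : ℂ) (a : A) (y : X) : a • c • y = c • a • y :=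
    (of_unital A X).act_smul c a y
  -- `ULift` moves `M` to the universe over which `maximalRangeInter` quantifies.
  have : LeftBanachModule A (ULift.{u} M) :=
    { act_add := fun a y z => ULift.ext _ _ (smul_add a _ _)
      add_act := fun a b y => ULift.ext _ _ (add_smul a b _)
      mul_act := fun a b y => ULift.ext _ _ (mul_smul a b _)
      smul_act := fun c a y => ULift.ext _ _ (smul_assoc c a _)
      act_smul := fun c a y => ULift.ext _ _ (Subtype.ext (hcomm c a y.down))
      norm_act_le := fun a y => norm_smul_le a (y.down : X) }
  let ι : ULift.{u} M →L[ℂ] X := N.subtypeL.comp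
    (ContinuousLinearEquiv.ulift (R₁ := ℂ) (M₁ := N)).toContinuousLinearMap
  have hι_range : Set.range ι = (M : Set X) := by
    ext y
    exact ⟨fun ⟨m, hm⟩ => hm ▸ m.down.2, fun hy => ⟨⟨⟨y, hy⟩⟩, rfl⟩⟩
  have hι : IsMaximalContractiveMonomorphism A ι := by
    refine ⟨⟨⟨fun a y => rfl, fun y => le_rfl⟩, fun y z h => ULift.ext _ _ (Subtype.ext h)⟩, ?_, ?_⟩
    · rw [← Set.range_eq_univ, hι_range]
      exact fun h => hM.1 (SetLike.coe_injective h)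
    · intro Z _ _ _ _ _ β κ hβ hβs hκ hικ
      have hle : M ≤ rangeSubmodule β hβ.1.1 := by
        intro m hm
        exact ⟨κ ⟨⟨m, hm⟩⟩, (DFunLike.congr_fun hικ _).symm⟩
      have heq : rangeSubmodule β hβ.1.1 = M := by
        refine (hM.le_iff.mp hle).resolve_left fun h => hβs ?_
        exact Set.range_eq_univ.mp (congrArg (fun S : Submodule A X => (S : Set X)) h)
      -- Both factors of the isometric inclusion `β κ` are contractive, so `κ` preserves norms.
      refine ⟨AddMonoidHomClass.isometry_of_norm κ fun m => le_antisymm (hκ.2 m) ?_, fun z => ?_⟩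
      · calc ‖m‖ = ‖β (κ m)‖ := congrArg norm (DFunLike.congr_fun hικ m)
          _ ≤ ‖κ m‖ := hβ.1.2 _
      · have hz : β z ∈ M := heq ▸ (⟨z, rfl⟩ : β z ∈ rangeSubmodule β hβ.1.1)
        exact ⟨⟨⟨β z, hz⟩⟩, hβ.2 (DFunLike.congr_fun hικ _).symm⟩
  exact (Set.ext_iff.mp hι_range x).mp (hx _ ι hι)

variable [CompleteSpace A]

/-- If `N` is the range of a morphism and `N + A x` is the whole module, then a submodule that
contains `N` but not `x` stays away from `x`. -/
theorem notMem_closure_of_surjective_coprod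
    {Z : Type w} [NormedAddCommGroup Z] [NormedSpace ℂ Z] [CompleteSpace Z]
    {φ : Z →L[ℂ] X} {x : X}
    (hsurj : ∀ y : X, ∃ (z : Z) (a : A), φ z + a • x = y)
    {M : Submodule A X} (hφM : Set.range φ ⊆ M) (hx : x ∉ M) : x ∉ M.topologicalClosure := by
  let ψ : A →L[ℂ] X :=
    (LinearMap.toSpanSingleton A X x |>.restrictScalars ℂ).mkContinuous ‖x‖ fun a => by
      rw [mul_comm]; exact norm_smul_le a x
  -- Open mapping theorem: preimages can be chosen with norm at most `C` times that of the target.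
  -- For `m` within `C⁻¹` of `x`, the coefficient `a` in `x - m = φ z + a • x` then has norm below
  -- `1`.
  obtain ⟨C, hC, h⟩ := (φ.coprod ψ).exists_preimage_norm_le fun y => by
    obtain ⟨z, a, h⟩ := hsurj y
    exact ⟨(z, a), h⟩
  intro hcl
  obtain ⟨m, hm, hdist⟩ := Metric.mem_closure_iff.mp hcl C⁻¹ (inv_pos.mpr hC)
  obtain ⟨⟨z, a⟩, hza, hnorm⟩ := h (x - m)
  have ha : ‖a‖ < 1 := by
    calc ‖a‖ ≤ ‖(z, a)‖ := norm_snd_le (z, a)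
      _ ≤ C * ‖x - m‖ := hnorm
      _ < C * C⁻¹ := by rw [← dist_eq_norm]; gcongr
      _ = 1 := mul_inv_cancel₀ hC.ne'
  have hza' : φ z + a • x = x - m := hza
  have hmem : (1 - a) • x ∈ M := by
    have : (1 - a) • x = φ z + m := by
      rw [sub_smul, one_smul, sub_eq_iff_eq_add, add_right_comm, hza', sub_add_cancel]
    rw [this]
    exact M.add_mem (hφM ⟨z, rfl⟩) hm
  obtain ⟨b, hb⟩ := (isUnit_one_sub_of_norm_lt_one ha).exists_left_inv
  refine hx ?_
  have := M.smul_mem b hmem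
  rwa [smul_smul, hb, one_smul] at this

/-- A non-surjective morphism whose range together with `x` generates the module has range in a
closed maximal submodule that does not contain `x`. -/
theorem exists_isClosed_isCoatom
    {Z : Type w} [NormedAddCommGroup Z] [NormedSpace ℂ Z] [CompleteSpace Z] [SMul A Z]
    [LeftBanachModule A Z] {φ : Z →L[ℂ] X} (hφ : IsBanachModuleMorphism A φ) {x : X}
    (hsurj : ∀ y : X, ∃ (z : Z) (a : A), φ z + a • x = y) (hns : ¬ Function.Surjective φ) :
    ∃ M : Submodule A X, IsCoatom M ∧ IsClosed (M : Set X) ∧ x ∉ M := by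
  have top_of_mem (M : Submodule A X) (hN : rangeSubmodule φ hφ ≤ M) (hx : x ∈ M) : M = ⊤ := by
    refine (Submodule.eq_top_iff'.mpr fun y => ?_)
    obtain ⟨z, a, rfl⟩ := hsurj y
    exact M.add_mem (hN ⟨z, rfl⟩) (M.smul_mem a hx)
  have hxN : x ∉ rangeSubmodule φ hφ := fun h => hns <|
    Set.range_eq_univ.mp (congrArg (fun S : Submodule A X => (S : Set X)) (top_of_mem _ le_rfl h))
  -- Zorn is applied to submodules avoiding `x`; above `N`, avoiding `x` is the same as being
  -- proper.
  obtain ⟨M, hNM, hM⟩ := zorn_le_nonempty₀ {M : Submodule A X | x ∉ M}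
    (fun c hc hchain y hy => ⟨sSup c, fun h => by
      obtain ⟨S, hS, hxS⟩ := (Submodule.mem_sSup_of_directed ⟨y, hy⟩ hchain.directedOn).mp h
      exact hc hS hxS, fun _ => le_sSup⟩) _ hxN
  refine ⟨M, ⟨fun h => hM.1 (h ▸ Submodule.mem_top), fun S hS => ?_⟩, ?_, hM.1⟩
  · refine top_of_mem S (hNM.trans hS.le) ?_
    by_contra hxS
    exact hS.not_ge (hM.2 hxS hS.le)
  -- The closure of `M` still avoids `x`, so maximality forces it back into `M`.
  · have hle := hM.2 (notMem_closure_of_surjective_coprod hsurj hNM hM.1)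
      M.le_topologicalClosure
    exact isClosed_of_closure_subset hle

/-- An element of all closed maximal submodules lies in the range of a small morphism. -/
theorem mem_smallRangeUnion_of_forall_isCoatom {x : X}
    (hx : ∀ M : Submodule A X, IsCoatom M → IsClosed (M : Set X) → x ∈ M) :
    x ∈ smallRangeUnion A X := by
  have : LeftBanachModule A (ULift.{v} A) :=
    { act_add := fun a y z => ULift.ext _ _ (mul_add a _ _)
      add_act := fun a b y => ULift.ext _ _ (add_mul a b _)
      mul_act := fun a b y => ULift.ext _ _ (mul_assoc a b _)
      smul_act := fun c a y => ULift.ext _ _ (smul_mul_assoc c a _)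
      act_smul := fun c a y => ULift.ext _ _ (mul_smul_comm c a _)
      norm_act_le := fun a y => norm_mul_le a y.down }
  let ψ : ULift.{v} A →L[ℂ] X :=
    ((LinearMap.toSpanSingleton A X x |>.restrictScalars ℂ).comp
      (ULift.moduleEquiv (R := ℂ) (M := A)).toLinearMap).mkContinuous ‖x‖ fun a => by
      rw [mul_comm]; exact norm_smul_le a.down x
  refine ⟨ULift.{v} A, inferInstance, inferInstance, inferInstance, inferInstance, inferInstance,
    ψ, ⟨fun a b => mul_smul a b.down x, ?_⟩, ⟨⟨1⟩, one_smul A x⟩⟩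
  intro Z _ _ _ _ _ φ hφ hsurj
  by_contra hns
  obtain ⟨M, hM, hcl, hxM⟩ := exists_isClosed_isCoatom hφ (x := x) (fun y => by
    obtain ⟨⟨z, a⟩, h⟩ := hsurj y
    exact ⟨z, a.down, h⟩) hns
  exact hxM (hx M hM hcl)

end Unital

end LeftBanachModule

theorem mainTheorem1 (A : Type u) (X : Type v)
    [NormedRing A] [NormedAlgebra ℂ A] [CompleteSpace A]
    [NormedAddCommGroup X] [NormedSpace ℂ X] [CompleteSpace X]
    [Module A X] [IsScalarTower ℂ A X] [IsBoundedSMul A X] :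
    smallRangeUnion A X = maximalRangeInter A X ∧
      ∃ T : Submodule A X, (T : Set X) = smallRangeUnion A X ∧
        (T : Set X) = maximalRangeInter A X ∧ IsClosed (T : Set X) := by
  have h31 {x : X} (hx : ∀ M : Submodule A X, IsCoatom M → IsClosed (M : Set X) → x ∈ M) :
      x ∈ smallRangeUnion A X := LeftBanachModule.mem_smallRangeUnion_of_forall_isCoatom hx
  have h12 : smallRangeUnion A X ⊆ maximalRangeInter A X := by
    rintro x ⟨Y, _, _, _, _, _, ψ, hψ, hx⟩ Z _ _ _ _ _ ι hι
    exact LeftBanachModule.range_smallMorphism_subset_range_maximal hψ hι hx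
  have h23 {x : X} (hx : x ∈ maximalRangeInter A X) (M : Submodule A X) (hM : IsCoatom M)
      (hcl : IsClosed (M : Set X)) : x ∈ M := LeftBanachModule.mem_of_mem_maximalRangeInter hM hcl hx
  have heq : smallRangeUnion A X = maximalRangeInter A X :=
    h12.antisymm fun x hx => h31 (h23 hx)
  let T : Submodule A X := sInf {M : Submodule A X | IsCoatom M ∧ IsClosed (M : Set X)}
  have hT : (T : Set X) = smallRangeUnion A X := by
    ext x
    rw [SetLike.mem_coe, Submodule.mem_sInf]
    exact ⟨fun hx => h31 fun M hM hcl => hx M ⟨hM, hcl⟩,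
      fun hx M hM => h23 (h12 hx) M hM.1 hM.2⟩
  refine ⟨heq, T, hT, hT.trans heq, ?_⟩
  rw [Submodule.coe_sInf]
  exact isClosed_biInter fun M hM => hM.2
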